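/- Let $E$ be an infinite-dimensional real Banach space with dual $E^*$ and closed unit ball $B_E$. Let $H[E]$ be the space of all positively homogeneous functions $f\colon E^*\to\mathbb R$, that is, $f(\lambda x^*)=\lambda f(x^*)$ for all $\lambda\ge 0$ and $x^*\in E^*$, with pointwise operations. Let $H_\infty[E]$ be the subspace of those $f\in H[E]$ that are bounded on the closed unit ball $B_{E^*}$ of $E^*$. For $1\le p,q<\infty$ and $f\in H[E]$ put $$\|f\|_{p,q}=\sup\Bigl\{\Bigl(\sum_{k=1}^n|f(x_k^*)|^p\Bigr)^{1/p} : n\in\mathbb N,\ x_1^*,\dots,x_n^*\in E^*,\ \sup_{x\in B_E}\Bigl(\sum_{k=1}^n|x_k^*(x)|^q\Bigr)^{1/q}\le 1\Bigr\}\in[0,\infty],$$ and let $H_{p,q}[E]=\{f\in H[E] : \|f\|_{p,q}<\infty\}$. Suppose that $1\le q\le p<\infty$ and $\frac1q-\frac1p<\frac12$. Then $H_{p,q}[E]$ is a proper subspace of $H_\infty[E]$, i.e. $H_{p,q}[E]\subsetneq H_\infty[E]$. In particular, the dual norm $f(x^*)=\|x^*\|$ belongs to $H_\infty[E]$ but not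 to $H_{p,q}[E]$. -/

import Mathlib

open scoped ENNReal

noncomputable section

namespace NonlinearSumming

variable (E : Type*) [NormedAddCommGroup E] [NormedSpace ℝ E]

/-- `H[E]`: the vector space (with pointwise operations) of all positively homogeneous functions
`f : E* → ℝ` on the dual space `E*`. -/
def posHomSpace : Submodule ℝ (StrongDual ℝ E → ℝ) where
  carrier := {f | ∀ (c : ℝ) (x : StrongDual ℝ E), 0 ≤ c → f (c • x) = c * f x}
  add_mem' := by
    intro f g hf hg c x hc
    simp only [Pi.add_apply]
    rw [hf c x hc, hg c x hc]
    ring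
  zero_mem' := by
    intro c x _
    simp
  smul_mem' := by
    intro a f hf c x hc
    simp only [Pi.smul_apply, smul_eq_mul]
    rw [hf c x hc]
    ring

/-- `H_∞[E]`: the positively homogeneous functions `E* → ℝ` that are bounded on the closed unit
ball of `E*`. -/
def boundedPosHomSpace : Submodule ℝ (StrongDual ℝ E → ℝ) where
  carrier := {f | f ∈ posHomSpace E ∧
    ∃ C : ℝ, ∀ x ∈ Metric.closedBall (0 : StrongDual ℝ E) 1, |f x| ≤ C}
  add_mem' := by
    rintro f g ⟨hf, C, hC⟩ ⟨hg, D, hD⟩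
    exact ⟨add_mem hf hg, C + D, fun x hx =>
      (abs_add_le (f x) (g x)).trans (add_le_add (hC x hx) (hD x hx))⟩
  zero_mem' := ⟨zero_mem _, 0, fun x _ => by simp⟩
  smul_mem' := by
    rintro a f ⟨hf, C, hC⟩
    refine ⟨Submodule.smul_mem _ a hf, |a| * C, fun x hx => ?_⟩
    rw [Pi.smul_apply, smul_eq_mul, abs_mul]
    exact mul_le_mul_of_nonneg_left (hC x hx) (abs_nonneg a)

variable {E}

/-- The weak `q`-summing norm of a finite sequence `x` in `E*`, i.e. the supremum over `B_E` of
`(∑ₖ |xₖ(e)|^q)^(1/q)`, as an extended nonnegative real. -/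
def weakSumNorm (q : ℝ) {n : ℕ} (x : Fin n → StrongDual ℝ E) : ℝ≥0∞ :=
  ⨆ e ∈ Metric.closedBall (0 : E) 1, (∑ k, ‖x k e‖ₑ ^ q) ^ (1 / q)

/-- The `(p,q)`-summing norm `‖f‖_{p,q}` of `f : E* → ℝ`, i.e. the supremum of
`(∑ₖ |f(xₖ)|^p)^(1/p)` over all finite sequences `x` in `E*` with weak `q`-summing norm at
most `1`, as an extended nonnegative real. -/
def pqNorm (p q : ℝ) (f : StrongDual ℝ E → ℝ) : ℝ≥0∞ :=
  ⨆ (n : ℕ) (x : Fin n → StrongDual ℝ E) (_ : weakSumNorm q x ≤ 1),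
    (∑ k, ‖f (x k)‖ₑ ^ p) ^ (1 / p)

theorem le_pqNorm (p q : ℝ) (f : StrongDual ℝ E → ℝ) {n : ℕ} (x : Fin n → StrongDual ℝ E)
    (hx : weakSumNorm q x ≤ 1) : (∑ k, ‖f (x k)‖ₑ ^ p) ^ (1 / p) ≤ pqNorm p q f :=
  le_iSup_of_le n (le_iSup_of_le x (le_iSup_of_le hx le_rfl))

theorem pqNorm_add_le {p : ℝ} (hp : 1 ≤ p) (q : ℝ) (f g : StrongDual ℝ E → ℝ) :
    pqNorm p q (f + g) ≤ pqNorm p q f + pqNorm p q g := by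
  refine iSup_le fun n => iSup_le fun x => iSup_le fun hx => ?_
  calc (∑ k, ‖(f + g) (x k)‖ₑ ^ p) ^ (1 / p)
      ≤ (∑ k, (‖f (x k)‖ₑ + ‖g (x k)‖ₑ) ^ p) ^ (1 / p) := by
        gcongr with k
        exact enorm_add_le _ _
    _ ≤ (∑ k, ‖f (x k)‖ₑ ^ p) ^ (1 / p) + (∑ k, ‖g (x k)‖ₑ ^ p) ^ (1 / p) :=
        ENNReal.Lp_add_le _ _ _ hp
    _ ≤ pqNorm p q f + pqNorm p q g :=
        add_le_add (le_pqNorm p q f x hx) (le_pqNorm p q g x hx)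

theorem pqNorm_smul_le {p : ℝ} (hp : 1 ≤ p) (q : ℝ) (a : ℝ) (f : StrongDual ℝ E → ℝ) :
    pqNorm p q (a • f) ≤ ‖a‖ₑ * pqNorm p q f := by
  have hp0 : 0 < p := by linarith
  refine iSup_le fun n => iSup_le fun x => iSup_le fun hx => ?_
  calc (∑ k, ‖(a • f) (x k)‖ₑ ^ p) ^ (1 / p)
      = ‖a‖ₑ * (∑ k, ‖f (x k)‖ₑ ^ p) ^ (1 / p) := by
        simp only [Pi.smul_apply, enorm_smul, ENNReal.mul_rpow_of_nonneg _ _ hp0.le]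
        rw [← Finset.mul_sum, ENNReal.mul_rpow_of_nonneg _ _ (by positivity),
          ← ENNReal.rpow_mul, mul_one_div_cancel hp0.ne', ENNReal.rpow_one]
    _ ≤ ‖a‖ₑ * pqNorm p q f :=
        mul_le_mul' le_rfl (le_pqNorm p q f x hx)

variable (E)

/-- `H_{p,q}[E]`: the positively homogeneous functions `f : E* → ℝ` with `‖f‖_{p,q} < ∞`. -/
def pqSummingSpace (p q : ℝ) (hp : 1 ≤ p) : Submodule ℝ (StrongDual ℝ E → ℝ) where
  carrier := {f | f ∈ posHomSpace E ∧ pqNorm p q f < ∞}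
  add_mem' := by
    rintro f g ⟨hf, hf'⟩ ⟨hg, hg'⟩
    exact ⟨add_mem hf hg, (pqNorm_add_le hp q f g).trans_lt (ENNReal.add_lt_top.2 ⟨hf', hg'⟩)⟩
  zero_mem' := by
    refine ⟨zero_mem _, ?_⟩
    have h := pqNorm_smul_le hp q 0 (0 : StrongDual ℝ E → ℝ)
    simp only [zero_smul, enorm_zero, zero_mul] at h
    exact h.trans_lt ENNReal.zero_lt_top
  smul_mem' := by
    rintro a f ⟨hf, hf'⟩
    exact ⟨Submodule.smul_mem _ a hf,
      (pqNorm_smul_le hp q a f).trans_lt (ENNReal.mul_lt_top enorm_lt_top hf')⟩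

end NonlinearSumming

end

/-! The inclusion holds because one functional of norm at most `1` is already an admissible
sequence. Strictness comes from the Dvoretzky–Rogers lemma in the infinite-dimensional space `E*`:
for each `n` it yields functionals `x₁, …, xₙ` of norm at least `1/4` with weak `2`-summing norm at
most `1`. Multiplying them by `n ^ (-max 0 (1/q - 1/2))` makes the weak `q`-summing norm at most
`1`, while the `ℓ_p`-sum of their norms stays at least `n ^ (1/p - max 0 (1/q - 1/2)) / 4`. The
exponent is positive exactly when `1/q - 1/p < 1/2`, so the dual norm has infinite `(p,q)`-norm.

The Dvoretzky–Rogers lemma is a volume argument: among contractions from a Euclidean space into `F`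
that factor through a fixed injection, take one of maximal determinant. Were it small on a subspace
of at least half the dimension, stretching that subspace would increase the volume too much. -/

/-! ### Maximal-volume contractions and the Dvoretzky–Rogers lemma. -/

/-- The endomorphism acting as `2` on `K` and as `1` on `Kᗮ` has determinant `2 ^ dim K`. -/
theorem det_id_add_starProjection {H : Type*} [NormedAddCommGroup H]
    [InnerProductSpace ℝ H] [FiniteDimensional ℝ H] (K : Submodule ℝ H) :
    (ContinuousLinearMap.id ℝ H + K.starProjection).det = 2 ^ Module.finrank ℝ K := by
  set T : H →ₗ[ℝ] H := ((ContinuousLinearMap.id ℝ H + K.starProjection : H →L[ℝ] H) : H →ₗ[ℝ] H)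
    with hT
  have hTx : ∀ x, T x = x + K.starProjection x := fun x => rfl
  have hK : K ≤ K.comap T := fun x hx => by
    rw [Submodule.mem_comap, hTx]
    exact K.add_mem hx (K.starProjection_apply_mem x)
  have hres : T.restrict hK = (2 : ℝ) • LinearMap.id := by
    ext ⟨x, hx⟩
    simp [LinearMap.restrict_apply, hTx, Submodule.starProjection_eq_self_iff.2 hx, two_smul]
  have hquot : K.mapQ K T hK = LinearMap.id := by
    ext x
    simp only [LinearMap.comp_apply, Submodule.mkQ_apply, Submodule.mapQ_apply, LinearMap.id_apply,
      hTx]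
    rw [Submodule.Quotient.eq]
    simp
  change LinearMap.det T = _
  rw [LinearMap.det_eq_det_mul_det K T hK, hres, hquot, LinearMap.det_smul]
  simp

/-- A linear injection `j` can be modified to a contraction of maximal volume. -/
theorem exists_contraction_abs_det_le_pow {H F : Type*} [NormedAddCommGroup H]
    [NormedSpace ℝ H] [FiniteDimensional ℝ H] [NormedAddCommGroup F] [NormedSpace ℝ F]
    (j : H →L[ℝ] F) (hj : Function.Injective j) :
    ∃ u : H →L[ℝ] F, ‖u‖ ≤ 1 ∧ ∀ (A : H →L[ℝ] H) (c : ℝ), 0 < c → ‖u ∘L A‖ ≤ c →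
      |A.det| ≤ c ^ Module.finrank ℝ H := by
  set S : Set (H →L[ℝ] H) := {w | ‖j ∘L w‖ ≤ 1} with hS
  obtain ⟨C, hC0, hC⟩ := (LinearMap.injective_iff_antilipschitz (j : H →ₗ[ℝ] F)).1 hj
  have hbound : ∀ x, ‖x‖ ≤ C * ‖j x‖ := fun x => by
    simpa using hC.le_mul_dist x 0
  have hcomp : IsCompact S := by
    refine Metric.isCompact_of_isClosed_isBounded ?_ ?_
    · exact isClosed_le (by fun_prop) continuous_const
    · refine (Metric.isBounded_closedBall (x := (0 : H →L[ℝ] H)) (r := C)).subset fun w hw => ?_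
      rw [mem_closedBall_zero_iff]
      refine w.opNorm_le_bound C.coe_nonneg fun x => (hbound _).trans ?_
      refine mul_le_mul_of_nonneg_left ?_ C.coe_nonneg
      simpa using (j ∘L w).le_of_opNorm_le hw x
  -- Volume is measured by `|det w|` in the parametrization `j ∘L w`; the maximum exists because
  -- injectivity of `j` makes `S` compact.
  obtain ⟨w, hwS, hw⟩ := hcomp.exists_isMaxOn ⟨0, by simp [hS]⟩
    (ContinuousLinearMap.continuous_det (𝕜 := ℝ) (E := H)).abs.continuousOn
  have hdet_smul : ∀ (a : ℝ) (B : H →L[ℝ] H), (a • B).det = a ^ Module.finrank ℝ H * B.det :=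
    fun a B => LinearMap.det_smul a (B : H →ₗ[ℝ] H)
  -- A small multiple of the identity lies in `S`, so the maximum is positive and can be cancelled
  -- below.
  have hw0 : 0 < |w.det| := by
    set a : ℝ := (‖j‖ + 1)⁻¹ with ha
    have ha0 : 0 < a := by positivity
    have hmem : a • ContinuousLinearMap.id ℝ H ∈ S := by
      rw [hS, Set.mem_ofPred_eq, ContinuousLinearMap.comp_smul, norm_smul, Real.norm_of_nonneg ha0.le,
        ContinuousLinearMap.comp_id, ha, inv_mul_le_iff₀ (by positivity)]
      linarith
    refine lt_of_lt_of_le ?_ (hw hmem)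
    simp only [hdet_smul]
    have : (ContinuousLinearMap.id ℝ H).det = 1 := LinearMap.det_id
    rw [this]
    positivity
  refine ⟨j ∘L w, hwS, fun A c hc hA => ?_⟩
  -- The competitor `w ∘L (c⁻¹ • A)` has determinant `c ^ (-dim H) * det A * det w`; maximality of
  -- `|det w|` bounds `|det A|`.
  have hmem : w ∘L (c⁻¹ • A) ∈ S := by
    rw [hS, Set.mem_ofPred_eq, ← ContinuousLinearMap.comp_assoc, ContinuousLinearMap.comp_smul,
      norm_smul, Real.norm_of_nonneg (by positivity), inv_mul_le_iff₀ hc, mul_one]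
    exact hA
  have hle : |(w ∘L (c⁻¹ • A)).det| ≤ |w.det| := hw hmem
  have hmul : (w ∘L (c⁻¹ • A)).det = w.det * (c⁻¹ • A).det :=
    LinearMap.det_comp (w : H →ₗ[ℝ] H) ((c⁻¹ • A : H →L[ℝ] H) : H →ₗ[ℝ] H)
  rw [hmul, hdet_smul, abs_mul, abs_mul, mul_le_iff_le_one_right hw0, inv_pow, abs_inv,
    abs_of_pos (by positivity : 0 < c ^ Module.finrank ℝ H), inv_mul_le_iff₀ (by positivity),
    mul_one] at hle
  exact hle

/-- On subspaces of at least half the dimension, a contraction of maximal volume is not small. -/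
theorem exists_unit_mem_norm_ge_of_abs_det_le_pow {H F : Type*} [NormedAddCommGroup H]
    [InnerProductSpace ℝ H] [FiniteDimensional ℝ H] [NormedAddCommGroup F] [NormedSpace ℝ F]
    {u : H →L[ℝ] F} (hu : ‖u‖ ≤ 1)
    (hdet : ∀ (A : H →L[ℝ] H) (c : ℝ), 0 < c → ‖u ∘L A‖ ≤ c → |A.det| ≤ c ^ Module.finrank ℝ H)
    (K : Submodule ℝ H) (hK0 : 0 < Module.finrank ℝ K)
    (hK : Module.finrank ℝ H ≤ 2 * Module.finrank ℝ K) :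
    ∃ x ∈ K, ‖x‖ = 1 ∧ 1 / 4 ≤ ‖u x‖ := by
  by_contra! hsmall
  have hle : ∀ x ∈ K, ‖u x‖ ≤ 1 / 4 * ‖x‖ := fun x hx => by
    rcases eq_or_ne x 0 with rfl | hx0
    · simp
    have hn : 0 < ‖x‖ := norm_pos_iff.2 hx0
    have := (hsmall (‖x‖⁻¹ • x) (K.smul_mem _ hx) (by simp [norm_smul, hn.ne'])).le
    rw [map_smul, norm_smul, norm_inv, norm_norm, inv_mul_le_iff₀ hn] at this
    linarith
  -- Doubling `K` raises the norm only to `1 + 1/4`, yet multiplies the volume by `2 ^ dim K`. Since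
  -- `dim H ≤ 2 * dim K`, the volume bound is at most `(25/16) ^ dim K`, and `25/16 < 2`.
  have hA : ‖u ∘L (ContinuousLinearMap.id ℝ H + K.starProjection)‖ ≤ 5 / 4 := by
    refine ContinuousLinearMap.opNorm_le_bound _ (by norm_num) fun x => ?_
    calc ‖u (x + K.starProjection x)‖ ≤ ‖u x‖ + ‖u (K.starProjection x)‖ := by
          rw [map_add]; exact norm_add_le _ _
      _ ≤ 1 * ‖x‖ + 1 / 4 * ‖x‖ := by
          refine add_le_add (u.le_of_opNorm_le hu x) ((hle _ (K.starProjection_apply_mem x)).trans ?_)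
          exact mul_le_mul_of_nonneg_left (K.norm_starProjection_apply_le x) (by norm_num)
      _ = 5 / 4 * ‖x‖ := by ring
  have h := hdet _ _ (by norm_num) hA
  rw [det_id_add_starProjection, abs_of_pos (by positivity)] at h
  have h' : (2 : ℝ) ^ Module.finrank ℝ K ≤ (25 / 16) ^ Module.finrank ℝ K := by
    refine h.trans ((pow_le_pow_right₀ (by norm_num) hK).trans_eq ?_)
    rw [pow_mul]; norm_num
  exact absurd h' (not_le.2 (pow_lt_pow_left₀ (by norm_num) (by norm_num) hK0.ne'))

/-- **Dvoretzky–Rogers lemma**, in operator form. -/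
theorem exists_orthonormal_norm_ge {F : Type*} [NormedAddCommGroup F] [NormedSpace ℝ F]
    (hF : ¬ FiniteDimensional ℝ F) (n : ℕ) :
    ∃ u : EuclideanSpace ℝ (Fin (2 * n)) →L[ℝ] F, ‖u‖ ≤ 1 ∧
      ∃ e : Fin n → EuclideanSpace ℝ (Fin (2 * n)), Orthonormal ℝ e ∧ ∀ i, 1 / 4 ≤ ‖u (e i)‖ := by
  have hrank : ((2 * n : ℕ) : Cardinal) ≤ Module.rank ℝ F := by
    refine (Cardinal.natCast_lt_aleph0).le.trans ?_
    rw [← not_lt, Module.rank_lt_aleph0_iff]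
    exact hF
  obtain ⟨v, hv⟩ := exists_linearIndependent_of_le_rank hrank
  let j₀ : EuclideanSpace ℝ (Fin (2 * n)) →ₗ[ℝ] F :=
    Fintype.linearCombination ℝ v ∘ₗ (WithLp.linearEquiv 2 ℝ (Fin (2 * n) → ℝ)).toLinearMap
  have hj₀ : Function.Injective j₀ :=
    (linearIndependent_iff_injective_fintypeLinearCombination.1 hv).comp (WithLp.linearEquiv 2 ℝ _).injective
  obtain ⟨u, hu, hdet⟩ := exists_contraction_abs_det_le_pow (LinearMap.toContinuousLinearMap j₀) hj₀
  refine ⟨u, hu, ?_⟩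
  -- The vectors are chosen greedily for one fixed `u`. Dimension `2 * n` ensures that the
  -- orthogonal complement of fewer than `n` vectors still has at least half the dimension.
  suffices h : ∀ k ≤ n, ∃ e : Fin k → EuclideanSpace ℝ (Fin (2 * n)), Orthonormal ℝ e ∧
      ∀ i, 1 / 4 ≤ ‖u (e i)‖ from h n le_rfl
  intro k
  induction k with
  | zero => exact fun _ => ⟨Fin.elim0, ⟨fun i => i.elim0, fun i => i.elim0⟩, fun i => i.elim0⟩
  | succ k ih =>
    intro hk
    obtain ⟨e, he, hue⟩ := ih (by omega)
    set L := Submodule.span ℝ (Set.range e) with hL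
    have hLk : Module.finrank ℝ L = k := by
      simpa using finrank_span_eq_card he.linearIndependent
    have hsum := L.finrank_add_finrank_orthogonal
    rw [hLk, finrank_euclideanSpace_fin] at hsum
    obtain ⟨x, hxL, hx1, hux⟩ := exists_unit_mem_norm_ge_of_abs_det_le_pow hu hdet Lᗮ
      (by omega) (by rw [finrank_euclideanSpace_fin]; omega)
    have hxe : ∀ i, inner ℝ (e i) x = 0 := fun i =>
      (Submodule.mem_orthogonal _ _).1 hxL _ (Submodule.subset_span ⟨i, rfl⟩)
    refine ⟨Fin.snoc e x, ⟨fun i => ?_, fun i i' hii' => ?_⟩, fun i => ?_⟩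
    · induction i using Fin.lastCases with
      | last => simpa using hx1
      | cast i => simpa using he.1 i
    · induction i using Fin.lastCases with
      | last =>
        induction i' using Fin.lastCases with
        | last => exact absurd rfl hii'
        | cast i' => simpa [real_inner_comm] using hxe i'
      | cast i =>
        induction i' using Fin.lastCases with
        | last => simpa using hxe i
        | cast i' => simpa using he.2 (fun h => hii' (by rw [h]))
    · induction i using Fin.lastCases with
      | last => simpa using hux
      | cast i => simpa using hue i

/-! ### Weakly summing sequences in the dual. -/

/-- The dual of a normed space contains, for each `n`, vectors `x₁, …, xₙ` of norm at least `1 / 4`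
with weak `2`-summing norm at most `1`. -/
theorem exists_dual_sum_sq_le_one {E : Type*} [NormedAddCommGroup E] [NormedSpace ℝ E]
    (hE : ¬ FiniteDimensional ℝ E) (n : ℕ) :
    ∃ x : Fin n → StrongDual ℝ E, (∀ k, 1 / 4 ≤ ‖x k‖) ∧
      ∀ a : E, ‖a‖ ≤ 1 → ∑ k, ‖x k a‖ ^ 2 ≤ 1 := by
  -- `E` embeds in its bidual, which is finite-dimensional if `E*` is.
  have hF : ¬ FiniteDimensional ℝ (StrongDual ℝ E) := fun h => hE
    (FiniteDimensional.of_injective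
      (NormedSpace.inclusionInDoubleDualLi (𝕜 := ℝ) (E := E)).toLinearMap
      (NormedSpace.inclusionInDoubleDualLi (𝕜 := ℝ) (E := E)).injective)
  obtain ⟨u, hu, e, he, hue⟩ := exists_orthonormal_norm_ge hF n
  refine ⟨fun k => u (e k), hue, fun a ha => ?_⟩
  -- Evaluation at `a` after `u` is a functional of norm at most `1`; its Riesz vector `y` turns the
  -- claim into Bessel's inequality.
  let φ : StrongDual ℝ (EuclideanSpace ℝ (Fin (2 * n))) :=
    NormedSpace.inclusionInDoubleDual ℝ E a ∘L u
  have hφ : ‖φ‖ ≤ 1 := by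
    refine φ.opNorm_le_bound zero_le_one fun y => ?_
    calc ‖u y a‖ ≤ ‖u y‖ * ‖a‖ := (u y).le_opNorm a
      _ ≤ (1 * ‖y‖) * 1 :=
        mul_le_mul (u.le_of_opNorm_le hu y) ha (norm_nonneg _) (by positivity)
      _ = 1 * ‖y‖ := mul_one _
  set y := (InnerProductSpace.toDual ℝ (EuclideanSpace ℝ (Fin (2 * n)))).symm φ with hy
  have hyn : ‖y‖ ≤ 1 := by rw [hy, LinearIsometryEquiv.norm_map]; exact hφ
  have hval : ∀ k, u (e k) a = inner ℝ (e k) y := fun k => by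
    rw [real_inner_comm, hy, InnerProductSpace.toDual_symm_apply]
    rfl
  simp only [hval]
  exact (he.sum_inner_products_le y (s := Finset.univ)).trans (pow_le_one₀ (norm_nonneg _) hyn)

/-- Comparison of the `ℓ_q`-norm with the `ℓ_2`-norm on `ℝⁿ`, with the constant
`n ^ max 0 (1 / q - 1 / 2)`. -/
theorem sum_rpow_le_of_sum_sq_le_one {n : ℕ} {q : ℝ} (hq : 1 ≤ q) (hn : 0 < n) (a : Fin n → ℝ)
    (ha : ∀ k, 0 ≤ a k) (h : ∑ k, a k ^ 2 ≤ 1) :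
    ∑ k, ((n : ℝ) ^ (-max 0 (1 / q - 1 / 2)) * a k) ^ q ≤ 1 := by
  have hq0 : 0 < q := by linarith
  have hn0 : (0 : ℝ) < n := by exact_mod_cast hn
  have hsq : ∀ k, a k ^ (2 : ℝ) = a k ^ 2 := fun k => Real.rpow_two _
  rcases le_total q 2 with h2 | h2
  · have ht : 0 ≤ 1 / q - 1 / 2 := by
      rw [sub_nonneg]; exact one_div_le_one_div_of_le hq0 h2
    -- Power mean inequality with exponent `2 / q ≥ 1`, applied to the numbers `a k ^ q`.
    have hpm := Real.rpow_sum_le_const_mul_sum_rpow_of_nonneg (s := Finset.univ)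
      (f := fun k => a k ^ q) (p := 2 / q) (by rw [le_div_iff₀ hq0]; linarith)
      (fun k _ => Real.rpow_nonneg (ha k) q)
    have hpow : ∀ k, (a k ^ q) ^ (2 / q) = a k ^ 2 := fun k => by
      rw [← Real.rpow_mul (ha k), mul_div_cancel₀ _ hq0.ne', hsq]
    simp only [hpow, Finset.card_univ, Fintype.card_fin] at hpm
    have hS0 : 0 ≤ ∑ k, a k ^ q := Finset.sum_nonneg fun k _ => Real.rpow_nonneg (ha k) q
    have hS : ∑ k, a k ^ q ≤ (n : ℝ) ^ (1 - q / 2) := by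
      have h1 : (∑ k, a k ^ q) ^ (2 / q) ≤ (n : ℝ) ^ (2 / q - 1) :=
        hpm.trans (mul_le_of_le_one_right (by positivity) h)
      have h3 := Real.rpow_le_rpow (by positivity) h1 (by positivity : 0 ≤ q / 2)
      rwa [← Real.rpow_mul hS0, ← Real.rpow_mul hn0.le,
        show 2 / q * (q / 2) = 1 by field_simp, Real.rpow_one,
        show (2 / q - 1) * (q / 2) = 1 - q / 2 by field_simp] at h3
    rw [max_eq_right ht]
    simp only [fun k => Real.mul_rpow (Real.rpow_nonneg hn0.le (-(1 / q - 1 / 2))) (ha k) (z := q)]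
    rw [← Finset.mul_sum, ← Real.rpow_mul hn0.le,
      show -(1 / q - 1 / 2) * q = -(1 - q / 2) by field_simp, Real.rpow_neg hn0.le]
    exact (inv_mul_le_iff₀ (by positivity)).2 (by simpa using hS)
  · have ht : 1 / q - 1 / 2 ≤ 0 := by
      rw [sub_nonpos]; exact one_div_le_one_div_of_le (by norm_num) h2
    rw [max_eq_left ht]
    simp only [neg_zero, Real.rpow_zero, one_mul]
    refine (Finset.sum_le_sum fun k _ => ?_).trans h
    -- For `q ≥ 2` no factor is needed: on `[0, 1]` powers decrease with the exponent.
    have hak : a k ≤ 1 := by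
      have := (Finset.single_le_sum (f := fun k => a k ^ 2) (fun i _ => sq_nonneg _)
        (Finset.mem_univ k)).trans h
      exact (sq_le_one_iff₀ (ha k)).1 this
    rw [← hsq]
    exact Real.rpow_le_rpow_of_exponent_ge' (ha k) hak (by norm_num) h2

theorem enorm_rpow_eq_ofReal {G : Type*} [SeminormedAddCommGroup G] (x : G) {r : ℝ} (hr : 0 ≤ r) :
    ‖x‖ₑ ^ r = ENNReal.ofReal (‖x‖ ^ r) := by
  rw [← ofReal_norm, ENNReal.ofReal_rpow_of_nonneg (norm_nonneg x) hr]

/-! ### The `(p,q)`-summing norm of the dual norm, and the inclusion. -/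

namespace NonlinearSumming

variable {E : Type*} [NormedAddCommGroup E] [NormedSpace ℝ E]

theorem weakSumNorm_le_one {q : ℝ} (hq : 1 ≤ q) {n : ℕ} {x : Fin n → StrongDual ℝ E}
    (h : ∀ a : E, ‖a‖ ≤ 1 → ∑ k, ‖x k a‖ ^ q ≤ 1) : weakSumNorm q x ≤ 1 := by
  refine iSup₂_le fun a ha => ENNReal.rpow_le_one ?_ (by positivity)
  simp only [enorm_rpow_eq_ofReal _ (zero_le_one.trans hq)]
  rw [← ENNReal.ofReal_sum_of_nonneg fun k _ => by positivity]
  exact ENNReal.ofReal_le_one.2 (h a (mem_closedBall_zero_iff.1 ha))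

/-- A lower bound for the growth of the `(p,q)`-summing norm of the dual norm. -/
theorem rpow_le_pqNorm_norm (hE : ¬ FiniteDimensional ℝ E) {p q : ℝ} (hq : 1 ≤ q) (hp : 1 ≤ p)
    {n : ℕ} (hn : 0 < n) :
    ENNReal.ofReal ((n : ℝ) ^ (1 / p - max 0 (1 / q - 1 / 2)) * (1 / 4)) ≤
      pqNorm p q (fun x : StrongDual ℝ E => ‖x‖) := by
  obtain ⟨x, hx, hx2⟩ := exists_dual_sum_sq_le_one hE n
  have hp0 : 0 < p := by linarith
  have hn0 : (0 : ℝ) < n := by exact_mod_cast hn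
  set t := max 0 (1 / q - 1 / 2) with ht
  set c : ℝ := (n : ℝ) ^ (-t) with hc
  have hc0 : 0 < c := by positivity
  have hweak : weakSumNorm q (fun k => c • x k) ≤ 1 := weakSumNorm_le_one hq fun a ha => by
    simp only [smul_apply, norm_smul, Real.norm_of_nonneg hc0.le]
    exact sum_rpow_le_of_sum_sq_le_one hq hn (fun k => ‖x k a‖) (fun k => norm_nonneg _) (hx2 a ha)
  refine le_trans ?_ (le_pqNorm p q _ _ hweak)
  simp only [enorm_rpow_eq_ofReal _ hp0.le, norm_norm]
  rw [← ENNReal.ofReal_sum_of_nonneg fun k _ => by positivity,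
    ENNReal.ofReal_rpow_of_nonneg (Finset.sum_nonneg fun k _ => by positivity) (by positivity)]
  refine ENNReal.ofReal_le_ofReal ?_
  have hsum : (n : ℝ) * (c * (1 / 4)) ^ p ≤ ∑ k, ‖c • x k‖ ^ p := by
    have : ∑ _k : Fin n, (c * (1 / 4)) ^ p ≤ ∑ k, ‖c • x k‖ ^ p := by
      refine Finset.sum_le_sum fun k _ => Real.rpow_le_rpow (by positivity) ?_ hp0.le
      rw [norm_smul, Real.norm_of_nonneg hc0.le]
      exact mul_le_mul_of_nonneg_left (hx k) hc0.le
    simpa using this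
  refine le_trans (le_of_eq ?_) (Real.rpow_le_rpow (by positivity) hsum (by positivity))
  rw [Real.mul_rpow hn0.le (by positivity), ← Real.rpow_mul (by positivity),
    mul_one_div_cancel hp0.ne', Real.rpow_one, hc, sub_eq_add_neg, Real.rpow_add hn0, mul_assoc]

theorem pqNorm_norm_eq_top (hE : ¬ FiniteDimensional ℝ E) {p q : ℝ} (hq : 1 ≤ q) (hp : 1 ≤ p)
    (hpq : 1 / q - 1 / p < 1 / 2) : pqNorm p q (fun x : StrongDual ℝ E => ‖x‖) = ∞ := by
  -- The only use of `1/q - 1/p < 1/2`: it says `1/q - 1/2 < 1/p`.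
  have hs : 0 < 1 / p - max 0 (1 / q - 1 / 2) :=
    sub_pos.2 (max_lt (by positivity) (by linarith))
  have hlim : Filter.Tendsto
      (fun n : ℕ => ENNReal.ofReal ((n : ℝ) ^ (1 / p - max 0 (1 / q - 1 / 2)) * (1 / 4)))
      Filter.atTop (nhds ∞) :=
    ENNReal.tendsto_ofReal_nhds_top.2 <|
      ((tendsto_rpow_atTop hs).comp tendsto_natCast_atTop_atTop).atTop_mul_const (by norm_num)
  refine top_le_iff.1 (le_of_tendsto hlim ?_)
  filter_upwards [Filter.eventually_gt_atTop 0] with n hn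
  exact rpow_le_pqNorm_norm hE hq hp hn

/-- The sequence consisting of `x` alone is admissible, since `|x a| ≤ 1` on the unit ball. -/
theorem enorm_le_pqNorm {p q : ℝ} (hq : 1 ≤ q) (hp : 1 ≤ p) (f : StrongDual ℝ E → ℝ)
    {x : StrongDual ℝ E} (hx : ‖x‖ ≤ 1) : ‖f x‖ₑ ≤ pqNorm p q f := by
  have hp0 : 0 < p := by linarith
  have hweak : weakSumNorm q (fun _ : Fin 1 => x) ≤ 1 := weakSumNorm_le_one hq fun a ha => by
    simpa using Real.rpow_le_one (norm_nonneg (x a))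
      ((x.le_opNorm a).trans (mul_le_one₀ hx (norm_nonneg _) ha)) (by linarith : 0 ≤ q)
  have h := le_pqNorm p q f _ hweak
  simpa [← ENNReal.rpow_mul, mul_inv_cancel₀ hp0.ne'] using h

theorem pqSummingSpace_le_boundedPosHomSpace {p q : ℝ} (hq : 1 ≤ q) (hp : 1 ≤ p) :
    pqSummingSpace E p q hp ≤ boundedPosHomSpace E := by
  rintro f ⟨hf, hfin⟩
  refine ⟨hf, (pqNorm p q f).toReal, fun x hx => ?_⟩
  have h := ENNReal.toReal_mono hfin.ne (enorm_le_pqNorm hq hp f (mem_closedBall_zero_iff.1 hx))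
  simpa using h

theorem norm_mem_boundedPosHomSpace :
    (fun x : StrongDual ℝ E => ‖x‖) ∈ boundedPosHomSpace E := by
  refine ⟨fun c x hc => ?_, 1, fun x hx => ?_⟩
  · simp only [norm_smul, Real.norm_of_nonneg hc]
  · simpa using hx

end NonlinearSumming

theorem proposition7p5 (E : Type*) [NormedAddCommGroup E] [NormedSpace ℝ E] [CompleteSpace E]
    (hE : ¬ FiniteDimensional ℝ E) (p q : ℝ) (hq : 1 ≤ q) (hqp : q ≤ p)
    (hpq : 1 / q - 1 / p < 1 / 2) :
    NonlinearSumming.pqSummingSpace E p q (hq.trans hqp) <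
        NonlinearSumming.boundedPosHomSpace E ∧
      (fun x : StrongDual ℝ E => ‖x‖) ∈ NonlinearSumming.boundedPosHomSpace E ∧
      (fun x : StrongDual ℝ E => ‖x‖) ∉ NonlinearSumming.pqSummingSpace E p q (hq.trans hqp) := by
  have hnot : (fun x : StrongDual ℝ E => ‖x‖) ∉
      NonlinearSumming.pqSummingSpace E p q (hq.trans hqp) := fun h =>
    h.2.ne (NonlinearSumming.pqNorm_norm_eq_top hE hq (hq.trans hqp) hpq)
  exact ⟨SetLike.lt_iff_le_and_exists.2
    ⟨NonlinearSumming.pqSummingSpace_le_boundedPosHomSpace hq (hq.trans hqp), _,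
      NonlinearSumming.norm_mem_boundedPosHomSpace, hnot⟩,
    NonlinearSumming.norm_mem_boundedPosHomSpace, hnot⟩
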